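/- For $\psi\in L^2(\mathbb R)$ let $\mathcal W(\psi)=\{2^{n/2}\psi(2^n x-k): n,k\in\mathbb Z\}$, and call $\mathcal W(\psi)$ a Parseval frame for $L^2(\mathbb R)$ if $\sum_{n,k\in\mathbb Z}|\langle f,\,2^{n/2}\psi(2^n\cdot-k)\rangle|^2=\|f\|_2^2$ for all $f\in L^2(\mathbb R)$. The Fourier transform is $\hat f(\gamma)=\int f(x)e^{-2\pi i x\gamma}\,dx$, extended to a unitary operator on $L^2(\mathbb R)$. A measurable set $L\subseteq\widehat{\mathbb R}$ of finite measure is a Parseval frame wavelet set if $\mathcal W(\check{\mathbf 1}_L)$ is a Parseval frame for $L^2(\mathbb R)$, where $\check{\mathbf 1}_L$ is the inverse Fourier transform of the characteristic function of $L$. The support $\operatorname{supp} f$ of a measurable function $f$ is understood as the set $\{f\neq 0\}$, determined up to null sets. Let $L\subseteq\widehat{\mathbb R}$ be a Parseval frame wavelet set, and let $N\in\mathbb Z$ be such that $\overline{2^N L}\subseteq(-\tfrac12,\tfrac12)$. Then for every $\varepsilon>0$ there exists a Schwartz function $\psi\in\mathscr S(\mathbb R)$ such that $\hat\psi\in C_c^\infty(\mathbb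 R)$, $\mathcal W(\psi)$ is a Parseval frame for $L^2(\mathbb R)$, and the Lebesgue measure of $\operatorname{supp}\hat\psi\setminus 2^N L$ is less than $\varepsilon$. -/

import Mathlib

open MeasureTheory
open scoped FourierTransform SchwartzMap Pointwise ContDiff

noncomputable section

/-- The family `e` is a frame for the complex Hilbert space `H` with (not necessarily optimal)
frame bounds `A` and `B`. -/
def IsFrameWithBounds {J H : Type*} [NormedAddCommGroup H] [InnerProductSpace ℂ H]
    (e : J → H) (A B : ℝ) : Prop :=
  0 < A ∧ A ≤ B ∧ ∀ f : H,
    Summable (fun j => ‖inner ℂ (e j) f‖ ^ 2) ∧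
    A * ‖f‖ ^ 2 ≤ ∑' j, ‖inner ℂ (e j) f‖ ^ 2 ∧
    ∑' j, ‖inner ℂ (e j) f‖ ^ 2 ≤ B * ‖f‖ ^ 2

/-- A Parseval frame: both frame bounds equal `1`. In a nonzero Hilbert space these bounds
are automatically optimal. -/
def IsParsevalFrame {J H : Type*} [NormedAddCommGroup H] [InnerProductSpace ℂ H]
    (e : J → H) : Prop :=
  IsFrameWithBounds e 1 1

/-- The Hilbert space `L²(ℝ)` of complex-valued functions. -/
abbrev L2R : Type := Lp ℂ 2 (volume : Measure ℝ)

/-- The function `x ↦ 2^{n/2} ψ(2^n x - k)`. -/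
def dyadicWavelet (ψ : ℝ → ℂ) (n k : ℤ) (x : ℝ) : ℂ :=
  (((2 : ℝ) ^ ((n : ℝ) / 2) : ℝ) : ℂ) * ψ ((2 : ℝ) ^ n * x - (k : ℝ))

theorem memLp_dyadicWavelet {ψ : ℝ → ℂ} (hψ : MemLp ψ 2 volume) (n k : ℤ) :
    MemLp (dyadicWavelet ψ n k) 2 volume := by
  have h2 : (2 : ℝ) ^ n ≠ 0 := zpow_ne_zero _ two_ne_zero
  have h1 : MemLp (fun y : ℝ => ψ (y - (k : ℝ))) 2 volume :=
    hψ.comp_measurePreserving (measurePreserving_sub_right volume (k : ℝ))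
  have hs : MemLp (fun y : ℝ => ψ (y - (k : ℝ))) 2
      (Measure.map (fun x : ℝ => (2 : ℝ) ^ n * x) volume) := by
    rw [Real.map_volume_mul_left h2]
    exact h1.smul_measure ENNReal.ofReal_ne_top
  exact (hs.comp_of_map (measurable_const_mul _).aemeasurable).const_mul _

/-- The dyadic wavelet system `𝓦(ψ)` of `ψ ∈ L²(ℝ)`, as a family in `L²(ℝ)` indexed by the
dilation and translation parameters `(n, k)`. -/
def waveletSystem (ψ : L2R) (p : ℤ × ℤ) : L2R :=
  (memLp_dyadicWavelet (Lp.memLp ψ) p.1 p.2).toLp (dyadicWavelet ψ p.1 p.2)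

/-- `ψ` is a Parseval frame wavelet: `𝓦(ψ)` is a Parseval frame for `L²(ℝ)`. -/
def IsParsevalFrameWavelet (ψ : L2R) : Prop :=
  IsParsevalFrame (waveletSystem ψ)

/-- `L` is a Parseval frame wavelet set: it is measurable, its characteristic function lies in
`L²` (equivalently `L` has finite measure), and the inverse `L²` Fourier transform of that
function is a Parseval frame wavelet. -/
def IsParsevalFrameWaveletSet (L : Set ℝ) : Prop :=
  ∃ (hL : MeasurableSet L) (hfin : volume L ≠ ⊤),
    IsParsevalFrameWavelet (𝓕⁻ (indicatorConstLp 2 hL hfin (1 : ℂ) : L2R))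

/-- `S` represents the support of `f` in the measure-theoretic sense: `S` is measurable, `f`
vanishes almost everywhere outside `S`, and `f` is nonzero almost everywhere on `S`. Such an `S`
is unique up to a null set. -/
def IsSupportOf (f : ℝ → ℂ) (S : Set ℝ) : Prop :=
  MeasurableSet S ∧ (∀ᵐ x, x ∉ S → f x = 0) ∧ (∀ᵐ x, x ∈ S → f x ≠ 0)

theorem isSupportOf_support {f : ℝ → ℂ} (hf : Measurable f) :
    IsSupportOf f (Function.support f) :=
  ⟨measurableSet_support hf, by simp, by simp⟩

end

theorem map_affine_volume {a : ℝ} (ha : a ≠ 0) (b : ℝ) :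
    Measure.map (fun x : ℝ => a * x - b) volume = ENNReal.ofReal |a⁻¹| • volume := by
  have h : (fun x : ℝ => a * x - b) = (fun y => y - b) ∘ (fun x => a * x) := rfl
  rw [h, ← Measure.map_map (measurable_sub_const b) (measurable_const_mul a),
    Real.map_volume_mul_left ha, Measure.map_smul, (measurePreserving_sub_right volume b).map_eq]

theorem quasiMeasurePreserving_affine {a : ℝ} (ha : a ≠ 0) (b : ℝ) :
    Measure.QuasiMeasurePreserving (fun x : ℝ => a * x - b) volume volume := by
  refine ⟨by fun_prop, ?_⟩
  rw [map_affine_volume ha]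
  exact Measure.smul_absolutelyContinuous

theorem memLp_comp_affine {a : ℝ} (ha : a ≠ 0) (b : ℝ) {g : ℝ → ℂ} (hg : MemLp g 2 volume) :
    MemLp (fun x => g (a * x - b)) 2 volume := by
  have h : MemLp g 2 (Measure.map (fun x : ℝ => a * x - b) volume) := by
    rw [map_affine_volume ha]
    exact hg.smul_measure ENNReal.ofReal_ne_top
  exact h.comp_of_map (by fun_prop)

theorem eLpNorm_comp_affine {a : ℝ} (ha : a ≠ 0) (b : ℝ) {g : ℝ → ℂ}
    (hg : AEStronglyMeasurable g volume) :
    eLpNorm (fun x => g (a * x - b)) 2 volume =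
      ENNReal.ofReal |a⁻¹| ^ (1 / 2 : ℝ) * eLpNorm g 2 volume := by
  have h : AEStronglyMeasurable g (Measure.map (fun x : ℝ => a * x - b) volume) :=
    hg.mono_ac (quasiMeasurePreserving_affine ha b).absolutelyContinuous
  have h2 := eLpNorm_map_measure (p := 2) h (by fun_prop)
  rw [map_affine_volume ha, eLpNorm_smul_measure_of_ne_zero (by simpa using ha)] at h2
  rw [show (fun x => g (a * x - b)) = g ∘ fun x => a * x - b from rfl, ← h2]
  simp

theorem norm_mul_le_of_norm_le {u g : ℝ → ℂ} {C : ℝ} (hC : ∀ x, ‖u x‖ ≤ C) :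
    ∀ᵐ x : ℝ, ‖u x * g x‖ ≤ C * ‖g x‖ :=
  Filter.Eventually.of_forall fun x => by
    rw [norm_mul]
    exact mul_le_mul_of_nonneg_right (hC x) (norm_nonneg _)

theorem memLp_weightedAffine {u : ℝ → ℂ} (hu : Measurable u) {C : ℝ} (hC : ∀ x, ‖u x‖ ≤ C)
    {a : ℝ} (ha : a ≠ 0) (b : ℝ) (g : L2R) :
    MemLp (fun x => u x * g (a * x - b)) 2 volume :=
  MemLp.of_le_mul (memLp_comp_affine ha b (Lp.memLp g))
    (hu.aestronglyMeasurable.mul (memLp_comp_affine ha b (Lp.memLp g)).1)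
    (norm_mul_le_of_norm_le hC)

/-- The operator `g ↦ u(x) g(a x - b)` on `L²(ℝ)`, for a bounded measurable weight `u`. -/
noncomputable def weightedAffine {u : ℝ → ℂ} (hu : Measurable u) {C : ℝ} (hC : ∀ x, ‖u x‖ ≤ C)
    {a : ℝ} (ha : a ≠ 0) (b : ℝ) : L2R →L[ℂ] L2R :=
  have hmem := memLp_weightedAffine hu hC ha b
  LinearMap.mkContinuous
    { toFun := fun g => (hmem g).toLp
      map_add' := fun f g => by
        ext1
        filter_upwards [(hmem (f + g)).coeFn_toLp, (hmem f).coeFn_toLp, (hmem g).coeFn_toLp,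
          Lp.coeFn_add (hmem f).toLp (hmem g).toLp,
          (quasiMeasurePreserving_affine ha b).ae (Lp.coeFn_add f g)] with x h1 h2 h3 h4 h5
        rw [h4, h1, h5, Pi.add_apply, Pi.add_apply, h2, h3, mul_add]
      map_smul' := fun c g => by
        ext1
        filter_upwards [(hmem (c • g)).coeFn_toLp, (hmem g).coeFn_toLp,
          Lp.coeFn_smul c (hmem g).toLp,
          (quasiMeasurePreserving_affine ha b).ae (Lp.coeFn_smul c g)] with x h1 h2 h4 h5
        rw [RingHom.id_apply, h4, h1, h5, Pi.smul_apply, Pi.smul_apply, h2, smul_eq_mul,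
          smul_eq_mul, mul_left_comm] }
    (C * (ENNReal.ofReal |a⁻¹| ^ (1 / 2 : ℝ)).toReal)
    (fun g => by
      have hC0 : 0 ≤ C := (norm_nonneg _).trans (hC 0)
      have h1 := eLpNorm_le_mul_eLpNorm_of_ae_le_mul
        (norm_mul_le_of_norm_le (g := fun x => g (a * x - b)) hC) 2
      rw [eLpNorm_comp_affine ha b (Lp.aestronglyMeasurable g)] at h1
      have h2 := ENNReal.toReal_mono (by
        refine ENNReal.mul_ne_top ENNReal.ofReal_ne_top (ENNReal.mul_ne_top ?_ (Lp.eLpNorm_ne_top g))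
        exact ENNReal.rpow_ne_top_of_nonneg (by norm_num) ENNReal.ofReal_ne_top) h1
      rw [ENNReal.toReal_mul, ENNReal.toReal_mul, ENNReal.toReal_ofReal hC0, ← mul_assoc] at h2
      rw [← Lp.norm_def] at h2
      exact (Lp.norm_toLp _ (hmem g)).trans_le h2)

theorem coeFn_weightedAffine {u : ℝ → ℂ} (hu : Measurable u) {C : ℝ} (hC : ∀ x, ‖u x‖ ≤ C)
    {a : ℝ} (ha : a ≠ 0) (b : ℝ) (g : L2R) :
    weightedAffine hu hC ha b g =ᵐ[volume] fun x => u x * g (a * x - b) :=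
  (memLp_weightedAffine hu hC ha b g).coeFn_toLp

theorem coeFn_waveletSystem (ψ : L2R) (p : ℤ × ℤ) :
    waveletSystem ψ p =ᵐ[volume] dyadicWavelet ψ p.1 p.2 :=
  MemLp.coeFn_toLp _

theorem continuous_waveletSystem (p : ℤ × ℤ) : Continuous fun ψ : L2R => waveletSystem ψ p := by
  have h : (fun ψ : L2R => waveletSystem ψ p) =
      weightedAffine (u := fun _ => (((2 : ℝ) ^ ((p.1 : ℝ) / 2) : ℝ) : ℂ)) measurable_const
        (fun _ => le_rfl) (zpow_ne_zero p.1 (two_ne_zero (α := ℝ))) (p.2 : ℝ) := by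
    funext ψ
    ext1
    exact (coeFn_waveletSystem ψ p).trans (coeFn_weightedAffine _ _ _ _ ψ).symm
  rw [h]
  exact ContinuousLinearMap.continuous _

/-- The modulation factor of the Fourier transform of `x ↦ 2^{n/2} ψ(2^n x - k)`. -/
noncomputable def waveletModulation (n k : ℤ) (γ : ℝ) : ℂ :=
  (((2 : ℝ) ^ (-(n : ℝ) / 2) : ℝ) : ℂ) * (𝐞 (-((2 : ℝ) ^ (-n) * k * γ)) : ℂ)

theorem measurable_waveletModulation (n k : ℤ) : Measurable (waveletModulation n k) := by
  unfold waveletModulation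
  have : Continuous fun γ : ℝ => (𝐞 (-((2 : ℝ) ^ (-n) * k * γ)) : ℂ) := by fun_prop
  exact this.measurable.const_mul _

theorem norm_waveletModulation (n k : ℤ) (γ : ℝ) :
    ‖waveletModulation n k γ‖ = (2 : ℝ) ^ (-(n : ℝ) / 2) := by
  rw [waveletModulation, norm_mul, Circle.norm_coe, mul_one, Complex.norm_real,
    Real.norm_of_nonneg (by positivity)]

theorem fourier_dyadicWavelet (ψ : ℝ → ℂ) (n k : ℤ) (γ : ℝ) :
    𝓕 (dyadicWavelet ψ n k) γ = waveletModulation n k γ * 𝓕 ψ ((2 : ℝ) ^ (-n) * γ) := by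
  have h2 : (2 : ℝ) ^ n ≠ 0 := zpow_ne_zero _ two_ne_zero
  rw [Real.fourier_real_eq, Real.fourier_real_eq]
  have e1 : ∀ x : ℝ, 𝐞 (-(x * γ)) • dyadicWavelet ψ n k x =
      (fun y : ℝ => (fun z : ℝ => 𝐞 (-((2 : ℝ) ^ (-n) * (z + k) * γ)) •
        ((((2 : ℝ) ^ ((n : ℝ) / 2) : ℝ) : ℂ) * ψ z)) (y - k)) ((2 : ℝ) ^ n * x) := by
    intro x
    simp only [dyadicWavelet, sub_add_cancel]
    rw [← mul_assoc ((2 : ℝ) ^ (-n)), zpow_neg, inv_mul_cancel₀ h2, one_mul]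
  simp_rw [e1]
  rw [Measure.integral_comp_mul_left (fun y : ℝ => (fun z : ℝ =>
    𝐞 (-((2 : ℝ) ^ (-n) * (z + k) * γ)) •
        ((((2 : ℝ) ^ ((n : ℝ) / 2) : ℝ) : ℂ) * ψ z)) (y - k)),
    integral_sub_right_eq_self (fun z : ℝ => 𝐞 (-((2 : ℝ) ^ (-n) * (z + k) * γ)) •
        ((((2 : ℝ) ^ ((n : ℝ) / 2) : ℝ) : ℂ) * ψ z)),
    ← integral_const_mul, ← integral_smul]
  congr 1
  funext z
  have e2 : -((2 : ℝ) ^ (-n) * (z + k) * γ) =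
      -((2 : ℝ) ^ (-n) * k * γ) + -(z * ((2 : ℝ) ^ (-n) * γ)) := by ring
  have e3 : |((2 : ℝ) ^ n)⁻¹| * (2 : ℝ) ^ ((n : ℝ) / 2) = (2 : ℝ) ^ (-(n : ℝ) / 2) := by
    rw [abs_of_pos (by positivity), ← Real.rpow_intCast, ← Real.rpow_neg (by norm_num),
      ← Real.rpow_add (by norm_num)]
    congr 1; ring
  rw [e2, AddChar.map_add_eq_mul, waveletModulation, ← e3]
  simp only [Circle.smul_def, Circle.coe_mul, smul_eq_mul, Complex.real_smul]
  push_cast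
  ring

/-- The dyadic wavelets of a Schwartz function, as Schwartz functions. -/
noncomputable def schwartzDyadicWavelet (ψ : 𝓢(ℝ, ℂ)) (n k : ℤ) : 𝓢(ℝ, ℂ) :=
  (((2 : ℝ) ^ ((n : ℝ) / 2) : ℝ) : ℂ) •
    SchwartzMap.compCLMOfContinuousLinearEquiv ℂ
      (ContinuousLinearEquiv.unitsEquivAut ℝ (Units.mk0 _ (zpow_ne_zero n (two_ne_zero (α := ℝ)))))
      (ψ.compSubConstCLM ℂ (k : ℝ))

theorem coe_schwartzDyadicWavelet (ψ : 𝓢(ℝ, ℂ)) (n k : ℤ) :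
    (schwartzDyadicWavelet ψ n k : ℝ → ℂ) = dyadicWavelet ψ n k := by
  funext x
  simp [schwartzDyadicWavelet, dyadicWavelet, mul_comm]

theorem waveletSystem_toLp (ψ : 𝓢(ℝ, ℂ)) (p : ℤ × ℤ) :
    waveletSystem (ψ.toLp 2 volume) p = (schwartzDyadicWavelet ψ p.1 p.2).toLp 2 volume := by
  ext1
  have h2 : (2 : ℝ) ^ p.1 ≠ 0 := zpow_ne_zero _ two_ne_zero
  filter_upwards [coeFn_waveletSystem (ψ.toLp 2 volume) p,
    (schwartzDyadicWavelet ψ p.1 p.2).coeFn_toLp 2 volume,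
    (quasiMeasurePreserving_affine h2 p.2).ae (ψ.coeFn_toLp 2 volume)] with x h1 h2 h3
  rw [h1, h2, coe_schwartzDyadicWavelet, dyadicWavelet, dyadicWavelet, h3]

theorem coeFn_fourier_waveletSystem (ψ : L2R) (p : ℤ × ℤ) :
    (𝓕 (waveletSystem ψ p) : L2R) =ᵐ[volume]
      fun γ => waveletModulation p.1 p.2 γ * (𝓕 ψ : L2R) ((2 : ℝ) ^ (-p.1) * γ) := by
  have h2 : (2 : ℝ) ^ (-p.1) ≠ 0 := zpow_ne_zero _ two_ne_zero
  let M : L2R →L[ℂ] L2R := weightedAffine (measurable_waveletModulation p.1 p.2)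
    (fun γ => (norm_waveletModulation p.1 p.2 γ).le) h2 0
  have key : 𝓕 (waveletSystem ψ p) = M (𝓕 ψ) := by
    refine DenseRange.induction_on (p := fun ψ : L2R => 𝓕 (waveletSystem ψ p) = M (𝓕 ψ))
      (SchwartzMap.denseRange_toLpCLM (E := ℝ) (F := ℂ) (p := 2) (μ := volume)
        ENNReal.ofNat_ne_top) ψ ?_ ?_
    · exact isClosed_eq
        ((Lp.fourierTransformₗᵢ ℝ ℂ).continuous.comp (continuous_waveletSystem p))
        (M.continuous.comp (Lp.fourierTransformₗᵢ ℝ ℂ).continuous)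
    · intro φ
      rw [SchwartzMap.toLpCLM_apply, waveletSystem_toLp, SchwartzMap.toLp_fourier_eq,
        SchwartzMap.toLp_fourier_eq]
      ext1
      filter_upwards [(𝓕 (schwartzDyadicWavelet φ p.1 p.2)).coeFn_toLp 2 volume,
        coeFn_weightedAffine (measurable_waveletModulation p.1 p.2)
          (fun γ => (norm_waveletModulation p.1 p.2 γ).le) h2 0 ((𝓕 φ).toLp 2 volume),
        (quasiMeasurePreserving_affine h2 0).ae ((𝓕 φ).coeFn_toLp 2 volume)] with x h1 h3 h4
      rw [h1, h3, h4, SchwartzMap.fourier_coe, SchwartzMap.fourier_coe,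
        coe_schwartzDyadicWavelet, fourier_dyadicWavelet, sub_zero]
  rw [key]
  simpa only [sub_zero] using coeFn_weightedAffine (measurable_waveletModulation p.1 p.2)
    (fun γ => (norm_waveletModulation p.1 p.2 γ).le) h2 0 (𝓕 ψ)

theorem inner_waveletSystem (ψ f : L2R) (p : ℤ × ℤ) :
    inner ℂ (waveletSystem ψ p) f =
      ∫ γ, (𝓕 f : L2R) γ * (starRingEnd ℂ) (waveletModulation p.1 p.2 γ *
        (𝓕 ψ : L2R) ((2 : ℝ) ^ (-p.1) * γ)) := by
  rw [← Lp.inner_fourier_eq, L2.inner_def]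
  refine integral_congr_ae ?_
  filter_upwards [coeFn_fourier_waveletSystem ψ p] with γ h
  rw [h, RCLike.inner_apply]

theorem exists_zpow_mul_mem_of_isParsevalFrameWaveletSet {L : Set ℝ}
    (hL : IsParsevalFrameWaveletSet L) : ∀ᵐ γ : ℝ, ∃ n : ℤ, (2 : ℝ) ^ n * γ ∈ L := by
  obtain ⟨hLm, hfin, hP⟩ := hL
  set Z : Set ℝ := {γ | ∃ n : ℤ, (2 : ℝ) ^ n * γ ∈ L}ᶜ with hZ
  have hZm : MeasurableSet Z := by
    refine MeasurableSet.compl ?_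
    rw [Set.ofPred_exists]
    exact MeasurableSet.iUnion fun n => measurable_const_mul _ hLm
  have hZR : ∀ m : ℕ, volume (Z ∩ Set.Icc (-m : ℝ) m) = 0 := by
    intro m
    have hBm := hZm.inter (measurableSet_Icc (a := (-m : ℝ)) (b := m))
    have hBf : volume (Z ∩ Set.Icc (-m : ℝ) m) ≠ ⊤ :=
      measure_ne_top_of_subset Set.inter_subset_right (by simp)
    let F : L2R := indicatorConstLp 2 hBm hBf (1 : ℂ)
    have hinner : ∀ p, inner ℂ (waveletSystem
        (𝓕⁻ (indicatorConstLp 2 hLm hfin (1 : ℂ) : L2R)) p) (𝓕⁻ F) = 0 := by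
      intro p
      rw [inner_waveletSystem, FourierTransform.fourier_fourierInv_eq,
        FourierTransform.fourier_fourierInv_eq]
      refine integral_eq_zero_of_ae ?_
      have h2 : (2 : ℝ) ^ (-p.1) ≠ 0 := zpow_ne_zero _ two_ne_zero
      filter_upwards [indicatorConstLp_coeFn (p := 2) (hs := hBm) (hμs := hBf) (c := (1 : ℂ)),
        (quasiMeasurePreserving_affine h2 0).ae
        (indicatorConstLp_coeFn (p := 2) (hs := hLm) (hμs := hfin) (c := (1 : ℂ)))] with γ h3 h4
      rw [sub_zero] at h4
      rw [h3, h4, Pi.zero_apply]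
      by_cases hγ : γ ∈ Z ∩ Set.Icc (-m : ℝ) m
      · have : (2 : ℝ) ^ (-p.1) * γ ∉ L := fun h => hγ.1 ⟨_, h⟩
        rw [Set.indicator_of_notMem this, mul_zero, map_zero, mul_zero]
      · rw [Set.indicator_of_notMem hγ, zero_mul]
    have h := (hP.2.2 (𝓕⁻ F)).2.1
    simp only [hinner, norm_zero, one_mul, ne_eq, OfNat.ofNat_ne_zero, not_false_eq_true,
      zero_pow, tsum_zero] at h
    have hF : 𝓕⁻ F = 0 := by
      rw [← norm_eq_zero]
      exact pow_eq_zero_iff two_ne_zero |>.1 (le_antisymm h (sq_nonneg _))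
    have hF0 : F = 0 := by
      rw [← FourierTransform.fourier_fourierInv_eq (F := L2R) F, hF]
      exact (Lp.fourierTransformₗᵢ ℝ ℂ).map_zero
    have hn := norm_indicatorConstLp (hs := hBm) (hμs := hBf) (c := (1 : ℂ))
      two_ne_zero ENNReal.ofNat_ne_top
    rw [show indicatorConstLp 2 hBm hBf (1 : ℂ) = 0 from hF0, norm_zero, norm_one, one_mul] at hn
    have := (Real.rpow_eq_zero measureReal_nonneg (by norm_num)).1 hn.symm
    exact (measureReal_eq_zero_iff hBf).1 this
  rw [ae_iff]
  refine measure_mono_null (t := ⋃ m : ℕ, Z ∩ Set.Icc (-m : ℝ) m) (fun γ hγ => ?_)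
    (measure_iUnion_null hZR)
  obtain ⟨m, hm⟩ := exists_nat_ge |γ|
  exact Set.mem_iUnion.2 ⟨m, hγ, abs_le.1 hm⟩

theorem integrable_norm_sq_L2R (F : L2R) : Integrable fun x => ‖F x‖ ^ 2 :=
  (Lp.memLp F).integrable_norm_pow two_ne_zero

theorem norm_sq_eq_integral_L2R (F : L2R) : ‖F‖ ^ 2 = ∫ x, ‖F x‖ ^ 2 := by
  have h := congr_arg Complex.re (L2.inner_def (𝕜 := ℂ) F F)
  rw [inner_self_eq_norm_sq_to_K] at h
  have e : ∀ x, inner ℂ (F x) (F x) = ((‖F x‖ ^ 2 : ℝ) : ℂ) := fun x => by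
    rw [inner_self_eq_norm_sq_to_K]; simp
  simp_rw [e] at h
  rw [integral_complex_ofReal] at h
  exact_mod_cast h

theorem inner_waveletSystem_eq_fourierCoeffOn {ψ : L2R} {g : ℝ → ℂ}
    (hψ : (𝓕 ψ : L2R) =ᵐ[volume] g) (hsupp : ∀ x ∉ Set.Ioo (-(1 / 2) : ℝ) (1 / 2), g x = 0)
    (f : L2R) (n k : ℤ) :
    inner ℂ (waveletSystem ψ (n, k)) f = (((2 : ℝ) ^ ((n : ℝ) / 2) : ℝ) : ℂ) *
      fourierCoeffOn (by norm_num : (-(1 / 2) : ℝ) < 1 / 2)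
        (fun ξ => (𝓕 f : L2R) ((2 : ℝ) ^ n * ξ) * (starRingEnd ℂ) (g ξ)) (-k) := by
  have hn : (2 : ℝ) ^ n ≠ 0 := zpow_ne_zero _ two_ne_zero
  have hn' : (2 : ℝ) ^ (-n) ≠ 0 := zpow_ne_zero _ two_ne_zero
  have h1 : ∫ γ, (𝓕 f : L2R) γ * (starRingEnd ℂ) (waveletModulation n k γ *
        (𝓕 ψ : L2R) ((2 : ℝ) ^ (-n) * γ)) =
      ∫ γ, (fun ξ : ℝ => (𝓕 f : L2R) ((2 : ℝ) ^ n * ξ) * (starRingEnd ℂ)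
        ((((2 : ℝ) ^ (-(n : ℝ) / 2) : ℝ) : ℂ) * (𝐞 (-(k * ξ)) : ℂ) * g ξ))
          ((2 : ℝ) ^ (-n) * γ) := by
    refine integral_congr_ae ?_
    filter_upwards [(quasiMeasurePreserving_affine hn' 0).ae hψ] with γ h
    rw [sub_zero] at h
    simp only [waveletModulation, h]
    rw [← mul_assoc ((2 : ℝ) ^ n), ← zpow_add₀ two_ne_zero, add_neg_cancel, zpow_zero, one_mul]
    ring_nf
  rw [inner_waveletSystem, h1, Measure.integral_comp_mul_left (fun ξ : ℝ =>
    (𝓕 f : L2R) ((2 : ℝ) ^ n * ξ) * (starRingEnd ℂ)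
      ((((2 : ℝ) ^ (-(n : ℝ) / 2) : ℝ) : ℂ) * (𝐞 (-(k * ξ)) : ℂ) * g ξ)),
    fourierCoeffOn_eq_integral, intervalIntegral.integral_of_le (by norm_num),
    ← setIntegral_eq_integral_of_forall_compl_eq_zero (s := Set.Ioc (-(1 / 2) : ℝ) (1 / 2)),
    ← integral_smul, ← integral_smul, ← integral_const_mul]
  · congr 1
    funext ξ
    have e3 : |((2 : ℝ) ^ (-n))⁻¹| * (2 : ℝ) ^ (-(n : ℝ) / 2) = (2 : ℝ) ^ ((n : ℝ) / 2) := by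
      rw [abs_of_pos (by positivity), zpow_neg, inv_inv, ← Real.rpow_intCast,
        ← Real.rpow_add (by norm_num)]
      congr 1; ring
    have e4 : (starRingEnd ℂ) (𝐞 (-(k * ξ)) : ℂ) =
        fourier (- -k) (ξ : AddCircle ((1 / 2 : ℝ) - -(1 / 2))) := by
      rw [fourier_coe_apply, ← Circle.coe_inv_eq_conj, ← AddChar.map_neg_eq_inv,
        Real.fourierChar_apply]
      norm_num
      ring_nf
    rw [← e3, ← e4]
    simp only [map_mul, Complex.conj_ofReal, Complex.real_smul, smul_eq_mul]
    push_cast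
    norm_num
    ring
  · intro ξ hξ
    rw [hsupp ξ fun h => hξ (Set.Ioo_subset_Ioc_self h), mul_zero, map_zero, mul_zero]

/-- Summing over translations: Parseval's identity for Fourier series. -/
theorem hasSum_inner_waveletSystem_translates {ψ : L2R} {g : ℝ → ℂ} (hg : Measurable g)
    (hψ : (𝓕 ψ : L2R) =ᵐ[volume] g) (hsupp : ∀ x ∉ Set.Ioo (-(1 / 2) : ℝ) (1 / 2), g x = 0)
    (hbd : ∀ᵐ x : ℝ, ‖g x‖ ≤ 1) (f : L2R) (n : ℤ) :
    HasSum (fun k : ℤ => ‖inner ℂ (waveletSystem ψ (n, k)) f‖ ^ 2)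
      (∫ γ, ‖g ((2 : ℝ) ^ (-n) * γ)‖ ^ 2 * ‖(𝓕 f : L2R) γ‖ ^ 2) := by
  have hn : (2 : ℝ) ^ n ≠ 0 := zpow_ne_zero _ two_ne_zero
  have hab : (-(1 / 2) : ℝ) < 1 / 2 := by norm_num
  set h : ℝ → ℂ := fun ξ => (𝓕 f : L2R) ((2 : ℝ) ^ n * ξ) * (starRingEnd ℂ) (g ξ) with hh
  have hF : MemLp (fun ξ => (𝓕 f : L2R) ((2 : ℝ) ^ n * ξ)) 2 volume := by
    simpa only [sub_zero] using memLp_comp_affine hn 0 (Lp.memLp (𝓕 f : L2R))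
  have hL2 : MemLp h 2 volume := by
    refine hF.mono (hF.1.mul (Complex.continuous_conj.measurable.comp hg).aestronglyMeasurable) ?_
    filter_upwards [hbd] with x hx
    rw [hh, norm_mul, RCLike.norm_conj]
    exact mul_le_of_le_one_right (norm_nonneg _) hx
  have hS := ((Equiv.neg ℤ).hasSum_iff.2
    (hasSum_sq_fourierCoeffOn hab (hL2.restrict (Set.Ioc (-(1 / 2)) (1 / 2))))).mul_left
    ((2 : ℝ) ^ n)
  have hval : (2 : ℝ) ^ n * (((1 / 2 : ℝ) - -(1 / 2))⁻¹ • ∫ x in (-(1 / 2) : ℝ)..1 / 2, ‖h x‖ ^ 2) =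
      ∫ γ, ‖g ((2 : ℝ) ^ (-n) * γ)‖ ^ 2 * ‖(𝓕 f : L2R) γ‖ ^ 2 := by
    rw [intervalIntegral.integral_of_le hab.le,
      setIntegral_eq_integral_of_forall_compl_eq_zero]
    · have e : ∀ γ : ℝ, ‖g ((2 : ℝ) ^ (-n) * γ)‖ ^ 2 * ‖(𝓕 f : L2R) γ‖ ^ 2 =
          (fun ξ => ‖h ξ‖ ^ 2) ((2 : ℝ) ^ (-n) * γ) := fun γ => by
        simp only [hh]
        rw [← mul_assoc ((2 : ℝ) ^ n), ← zpow_add₀ two_ne_zero, add_neg_cancel, zpow_zero,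
          one_mul, norm_mul, RCLike.norm_conj, mul_pow, mul_comm]
      simp_rw [e]
      rw [Measure.integral_comp_mul_left (fun ξ => ‖h ξ‖ ^ 2), abs_of_pos (by positivity),
        zpow_neg, inv_inv, smul_eq_mul, smul_eq_mul]
      norm_num
    · intro ξ hξ
      rw [hh]
      simp only [hsupp ξ fun h => hξ (Set.Ioo_subset_Ioc_self h)]
      simp
  rw [hval] at hS
  refine hS.congr_fun fun k => ?_
  rw [inner_waveletSystem_eq_fourierCoeffOn hψ hsupp, norm_mul, mul_pow, Complex.norm_real,
    Real.norm_of_nonneg (by positivity), ← Real.rpow_natCast, ← Real.rpow_mul (by norm_num)]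
  simp [hh]

/-- A function whose Fourier transform is supported in `(-1/2, 1/2)` and satisfies the Calderón
condition is a Parseval frame wavelet. -/
theorem isParsevalFrameWavelet_of_calderon {ψ : L2R} {g : ℝ → ℂ} (hg : Measurable g)
    (hψ : (𝓕 ψ : L2R) =ᵐ[volume] g) (hsupp : ∀ x ∉ Set.Ioo (-(1 / 2) : ℝ) (1 / 2), g x = 0)
    (hsum : ∀ᵐ x : ℝ, HasSum (fun n : ℤ => ‖g ((2 : ℝ) ^ n * x)‖ ^ 2) 1) :
    IsParsevalFrameWavelet ψ := by
  have hbd : ∀ᵐ x : ℝ, ‖g x‖ ≤ 1 := by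
    filter_upwards [hsum] with x hx
    have h := le_hasSum hx 0 fun n _ => sq_nonneg _
    rw [zpow_zero, one_mul] at h
    exact (sq_le_one_iff₀ (norm_nonneg _)).1 h
  refine ⟨one_pos, le_rfl, fun f => ?_⟩
  have hk := hasSum_inner_waveletSystem_translates hg hψ hsupp hbd f
  have hsum' : ∀ᵐ γ : ℝ, HasSum
      (fun n : ℤ => ‖g ((2 : ℝ) ^ (-n) * γ)‖ ^ 2 * ‖(𝓕 f : L2R) γ‖ ^ 2) (‖(𝓕 f : L2R) γ‖ ^ 2) := by
    filter_upwards [hsum] with γ hγ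
    simpa using ((Equiv.neg ℤ).hasSum_iff.2 hγ).mul_right (‖(𝓕 f : L2R) γ‖ ^ 2)
  have hn : HasSum (fun n : ℤ => ∫ γ, ‖g ((2 : ℝ) ^ (-n) * γ)‖ ^ 2 * ‖(𝓕 f : L2R) γ‖ ^ 2)
      (‖f‖ ^ 2) := by
    rw [← Lp.norm_fourier_eq f, norm_sq_eq_integral_L2R]
    refine hasSum_integral_of_dominated_convergence
      (fun n γ => ‖g ((2 : ℝ) ^ (-n) * γ)‖ ^ 2 * ‖(𝓕 f : L2R) γ‖ ^ 2) (fun n => ?_) (fun n => ?_)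
      ?_ ?_ hsum'
    · exact ((hg.comp (measurable_const_mul _)).norm.pow_const 2).aestronglyMeasurable.mul
        (integrable_norm_sq_L2R (𝓕 f)).1
    · exact Filter.Eventually.of_forall fun γ => (Real.norm_of_nonneg (by positivity)).le
    · filter_upwards [hsum'] with γ hγ using hγ.summable
    · refine (integrable_norm_sq_L2R (𝓕 f)).congr ?_
      filter_upwards [hsum'] with γ hγ using hγ.tsum_eq.symm
  have hs : Summable fun p => ‖inner ℂ (waveletSystem ψ p) f‖ ^ 2 := by
    rw [summable_prod_of_nonneg fun _ => sq_nonneg _]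
    exact ⟨fun n => (hk n).summable, hn.summable.congr fun n => (hk n).tsum_eq.symm⟩
  have ht : ∑' p, ‖inner ℂ (waveletSystem ψ p) f‖ ^ 2 = ‖f‖ ^ 2 :=
    (hs.hasSum.prod_fiberwise hk).unique hn
  exact ⟨hs, by rw [one_mul, ht], by rw [one_mul, ht]⟩

theorem exists_zpow_mul_abs_mem_Ico {x : ℝ} (hx : x ≠ 0) :
    ∃ n : ℤ, (2 : ℝ) ^ n * |x| ∈ Set.Ico (1 / 8 : ℝ) (1 / 4) := by
  obtain ⟨n, h1, h2⟩ := exists_mem_Ico_zpow (abs_pos.2 hx) (one_lt_two (α := ℝ))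
  have hpos : (0 : ℝ) < 2 ^ n := by positivity
  refine ⟨-n - 3, ?_⟩
  have e : (2 : ℝ) ^ (-n - 3) = ((2 : ℝ) ^ n)⁻¹ * (1 / 8) := by
    rw [zpow_sub₀ two_ne_zero, zpow_neg]; norm_num [div_eq_mul_inv]
  have e' : (2 : ℝ) ^ (n + 1) = 2 ^ n * 2 := by rw [zpow_add₀ two_ne_zero, zpow_one]
  have h3 : 1 ≤ ((2 : ℝ) ^ n)⁻¹ * |x| := by
    rw [← inv_mul_cancel₀ hpos.ne']
    exact mul_le_mul_of_nonneg_left h1 (by positivity)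
  have h4 : ((2 : ℝ) ^ n)⁻¹ * |x| < 2 := by
    rw [inv_mul_lt_iff₀ hpos, ← e']; exact h2
  rw [e]
  constructor <;> nlinarith

/-- A subset of `(-1/2, 1/2)` whose dyadic dilates cover almost everything can be replaced, up to
adding a set of small measure, by an open set away from `0` whose dyadic dilates cover
everything but `0`. -/
theorem exists_isOpen_dyadic_cover {K : Set ℝ} (hK : MeasurableSet K)
    (hsub : K ⊆ Set.Ioo (-(1 / 2) : ℝ) (1 / 2)) (hcov : ∀ᵐ x : ℝ, ∃ n : ℤ, (2 : ℝ) ^ n * x ∈ K)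
    {ε : ℝ} (hε : 0 < ε) :
    ∃ U : Set ℝ, IsOpen U ∧ U ⊆ Set.Ioo (-(1 / 2) : ℝ) (1 / 2) ∧
      (∃ δ > 0, ∀ x ∈ U, δ ≤ |x|) ∧ (∀ x : ℝ, x ≠ 0 → ∃ n : ℤ, (2 : ℝ) ^ n * x ∈ U) ∧
      volume (U \ K) < ENNReal.ofReal ε := by
  have hε2 : (0 : ENNReal) < ENNReal.ofReal (ε / 2) := by simpa using hε
  let A : ℕ → Set ℝ := fun m => K ∩ {x | 1 / ((m : ℝ) + 1) < |x|}
  have hAm : ∀ m, MeasurableSet (A m) := fun m =>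
    hK.inter (measurableSet_lt measurable_const measurable_norm)
  let D : Set ℝ := {x | |x| ∈ Set.Ico (1 / 8 : ℝ) (1 / 4)}
  have hDm : MeasurableSet D := measurable_norm measurableSet_Ico
  let B : ℕ → Set ℝ := fun m => D \ ⋃ n : ℤ, (fun x => (2 : ℝ) ^ n * x) ⁻¹' A m
  have hBm : ∀ m, MeasurableSet (B m) := fun m =>
    hDm.diff (MeasurableSet.iUnion fun n => measurable_const_mul _ (hAm m))
  have hBanti : Antitone B := by
    intro m m' h
    refine Set.sdiff_subset_sdiff_right (Set.iUnion_mono fun n => Set.preimage_mono ?_)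
    refine Set.inter_subset_inter_right _ ?_
    intro x hx
    rw [Set.mem_ofPred_eq] at hx ⊢
    refine lt_of_le_of_lt ?_ hx
    exact one_div_le_one_div_of_le (by positivity) (by exact_mod_cast Nat.add_le_add_right h 1)
  have hDfin : volume D ≠ ⊤ := by
    have : D ⊆ Set.Icc (-1) 1 := fun x hx => abs_le.1 (hx.2.le.trans (by norm_num))
    exact ((measure_mono this).trans_lt (by simp)).ne
  have hB0 : volume (⋂ m, B m) = 0 := by
    refine measure_mono_null (fun x hx => ?_) (ae_iff.1 hcov)
    rw [Set.mem_iInter] at hx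
    rintro ⟨n, hn⟩
    have hx0 : 0 < |(2 : ℝ) ^ n * x| := by
      have : (0 : ℝ) < |x| := lt_of_lt_of_le (by norm_num) (hx 0).1.1
      rw [abs_mul]; positivity
    obtain ⟨m, hm⟩ := exists_nat_one_div_lt hx0
    exact (hx m).2 (Set.mem_iUnion.2 ⟨n, hn, hm⟩)
  have hlim := tendsto_measure_iInter_atTop (μ := volume) (fun m => (hBm m).nullMeasurableSet)
    hBanti ⟨0, measure_ne_top_of_subset Set.sdiff_subset hDfin⟩
  rw [hB0] at hlim
  obtain ⟨m, hm⟩ := (hlim.eventually_lt_const hε2).exists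
  have hAfin : volume (A m) ≠ ⊤ :=
    measure_ne_top_of_subset (Set.inter_subset_left.trans hsub) (by simp)
  obtain ⟨U₀, hAU, hU₀, -, hUA⟩ := (hAm m).exists_isOpen_sdiff_lt hAfin hε2.ne'
  let U₁ := U₀ ∩ (Set.Ioo (-(1 / 2) : ℝ) (1 / 2) ∩ {x | 1 / ((m : ℝ) + 1) < |x|})
  let C := D \ ⋃ n : ℤ, (fun x => (2 : ℝ) ^ n * x) ⁻¹' U₁
  have hCB : C ⊆ B m := Set.sdiff_subset_sdiff_right (Set.iUnion_mono fun n => Set.preimage_mono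
    fun x hx => ⟨hAU hx, hsub hx.1, hx.2⟩)
  obtain ⟨V, hCV, hV, hVlt⟩ := Set.exists_isOpen_lt_of_lt C _ ((measure_mono hCB).trans_lt hm)
  let V₁ := V ∩ (Set.Ioo (-(1 / 2) : ℝ) (1 / 2) ∩ {x | 1 / 16 < |x|})
  have hopen : ∀ c : ℝ, IsOpen {x : ℝ | c < |x|} := fun c =>
    isOpen_lt continuous_const continuous_abs
  refine ⟨U₁ ∪ V₁, (hU₀.inter (isOpen_Ioo.inter (hopen _))).union
    (hV.inter (isOpen_Ioo.inter (hopen _))), ?_, ⟨min (1 / ((m : ℝ) + 1)) (1 / 16), by positivity,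
    ?_⟩, ?_, ?_⟩
  · rintro x (hx | hx)
    exacts [hx.2.1, hx.2.1]
  · rintro x (hx | hx)
    exacts [(min_le_left _ _).trans hx.2.2.le, (min_le_right _ _).trans hx.2.2.le]
  · intro x hx
    obtain ⟨n, hn⟩ := exists_zpow_mul_abs_mem_Ico hx
    have hD : (2 : ℝ) ^ n * x ∈ D := by
      rwa [Set.mem_ofPred_eq, abs_mul, abs_of_pos (by positivity : (0 : ℝ) < 2 ^ n)]
    by_cases hC : (2 : ℝ) ^ n * x ∈ C
    · refine ⟨n, Or.inr ⟨hCV hC, abs_lt.1 (hD.2.trans (by norm_num)), ?_⟩⟩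
      exact lt_of_lt_of_le (by norm_num) hD.1
    · have : (2 : ℝ) ^ n * x ∈ ⋃ n : ℤ, (fun x => (2 : ℝ) ^ n * x) ⁻¹' U₁ := by
        by_contra h
        exact hC ⟨hD, h⟩
      obtain ⟨n', hn'⟩ := Set.mem_iUnion.1 this
      refine ⟨n' + n, Or.inl ?_⟩
      rw [zpow_add₀ two_ne_zero, mul_assoc]
      exact hn'
  · calc volume ((U₁ ∪ V₁) \ K) ≤ volume (U₀ \ A m ∪ V) := by
          refine measure_mono ?_
          rintro x ⟨hx | hx, hxK⟩
          exacts [Or.inl ⟨hx.1, fun h => hxK h.1⟩, Or.inr hx.1]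
      _ ≤ volume (U₀ \ A m) + volume V := measure_union_le _ _
      _ < ENNReal.ofReal (ε / 2) + ENNReal.ofReal (ε / 2) := ENNReal.add_lt_add hUA hVlt
      _ = ENNReal.ofReal ε := by
          rw [← ENNReal.ofReal_add (by positivity) (by positivity), add_halves]

theorem exists_finset_dyadic_mul_notMem {U : Set ℝ} (hsub : U ⊆ Set.Ioo (-(1 / 2) : ℝ) (1 / 2))
    {δ : ℝ} (hδ : 0 < δ) (hU : ∀ x ∈ U, δ ≤ |x|) {x₀ : ℝ} (hx₀ : x₀ ≠ 0) :
    ∃ F : Finset ℤ, ∀ᶠ x in nhds x₀, ∀ n ∉ F, (2 : ℝ) ^ n * x ∉ U := by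
  have hr : 0 < |x₀| := abs_pos.2 hx₀
  obtain ⟨M, hM⟩ := pow_unbounded_of_one_lt (max (|x₀|⁻¹) (2 * |x₀| / δ)) (one_lt_two (α := ℝ))
  have hM1 : 1 < (2 : ℝ) ^ M * |x₀| := by
    rw [← inv_lt_iff_one_lt_mul₀ hr]; exact (le_max_left _ _).trans_lt hM
  have hM2 : 2 * |x₀| < (2 : ℝ) ^ M * δ := by
    rw [← div_lt_iff₀ hδ]; exact (le_max_right _ _).trans_lt hM
  have h1 : ∀ᶠ x : ℝ in nhds x₀, |x₀| / 2 < |x| :=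
    continuous_abs.continuousAt.eventually (lt_mem_nhds (by linarith))
  have h2 : ∀ᶠ x : ℝ in nhds x₀, |x| < 2 * |x₀| :=
    continuous_abs.continuousAt.eventually (gt_mem_nhds (by linarith))
  refine ⟨Finset.Icc (-(M : ℤ)) M, ?_⟩
  filter_upwards [h1, h2] with x hx1 hx2 n hn hxU
  have ha : |(2 : ℝ) ^ n * x| = 2 ^ n * |x| := by
    rw [abs_mul, abs_of_pos (by positivity : (0 : ℝ) < 2 ^ n)]
  rw [Finset.mem_Icc, not_and_or, not_le, not_le] at hn
  rcases hn with hn | hn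
  · have h3 : (2 : ℝ) ^ n ≤ 2 ^ (-(M : ℤ)) := zpow_le_zpow_right₀ one_le_two hn.le
    rw [zpow_neg, zpow_natCast] at h3
    have h4 := hU _ hxU
    rw [ha] at h4
    have h5 : (2 : ℝ) ^ n * |x| ≤ ((2 : ℝ) ^ M)⁻¹ * (2 * |x₀|) := by gcongr
    have h6 : ((2 : ℝ) ^ M)⁻¹ * (2 * |x₀|) < δ := by
      rwa [inv_mul_lt_iff₀ (by positivity)]
    linarith
  · have h3 : (2 : ℝ) ^ (M : ℤ) ≤ 2 ^ n := zpow_le_zpow_right₀ one_le_two hn.le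
    rw [zpow_natCast] at h3
    have h4 := abs_lt.2 (hsub hxU)
    rw [ha] at h4
    have h5 : (2 : ℝ) ^ M * (|x₀| / 2) ≤ (2 : ℝ) ^ n * |x| := by gcongr
    linarith

/-- Smooth Calderón partition of unity subordinate to an open set away from `0` whose dyadic
dilates cover `ℝ \ {0}`. -/
theorem exists_contDiff_dyadic_partition {U : Set ℝ} (hUo : IsOpen U)
    (hsub : U ⊆ Set.Ioo (-(1 / 2) : ℝ) (1 / 2)) {δ : ℝ} (hδ : 0 < δ) (hU : ∀ x ∈ U, δ ≤ |x|)
    (hcov : ∀ x : ℝ, x ≠ 0 → ∃ n : ℤ, (2 : ℝ) ^ n * x ∈ U) :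
    ∃ g : ℝ → ℝ, ContDiff ℝ ∞ g ∧ Function.support g ⊆ U ∧
      ∀ x : ℝ, x ≠ 0 → HasSum (fun n : ℤ => g ((2 : ℝ) ^ n * x) ^ 2) 1 := by
  obtain ⟨φ, hφs, hφc, hφr⟩ := hUo.exists_contDiff_support_eq (n := ⊤)
  have hφ0 : ∀ x, x ∉ U → φ x = 0 := fun x hx => by
    rw [← hφs] at hx; exact Function.notMem_support.1 hx
  let s : ℝ → ℝ := fun x => ∑' n : ℤ, φ ((2 : ℝ) ^ n * x) ^ 2
  have hfin := fun {x₀ : ℝ} (hx₀ : x₀ ≠ 0) => exists_finset_dyadic_mul_notMem hsub hδ hU hx₀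
  have hsum : ∀ x : ℝ, x ≠ 0 → Summable fun n : ℤ => φ ((2 : ℝ) ^ n * x) ^ 2 := fun x hx => by
    obtain ⟨F, hF⟩ := hfin hx
    refine summable_of_ne_finset_zero (s := F) fun n hn => ?_
    rw [hφ0 _ (hF.self_of_nhds n hn)]; norm_num
  have hspos : ∀ x : ℝ, x ≠ 0 → 0 < s x := fun x hx => by
    obtain ⟨n, hn⟩ := hcov x hx
    rw [← hφs] at hn
    exact (hsum x hx).tsum_pos (fun _ => sq_nonneg _) n (sq_pos_of_ne_zero hn)
  have hsmooth : ∀ x : ℝ, x ≠ 0 → ContDiffAt ℝ ∞ s x := fun x hx => by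
    obtain ⟨F, hF⟩ := hfin hx
    have he : s =ᶠ[nhds x] fun x => ∑ n ∈ F, φ ((2 : ℝ) ^ n * x) ^ 2 := by
      filter_upwards [hF] with y hy
      refine tsum_eq_sum fun n hn => ?_
      rw [hφ0 _ (hy n hn)]; norm_num
    refine ContDiffAt.congr_of_eventuallyEq ?_ he
    exact ContDiff.contDiffAt (ContDiff.sum fun n _ =>
      (hφc.comp (contDiff_const.mul contDiff_id)).pow 2)
  have hinv : ∀ (m : ℤ) (x : ℝ), s ((2 : ℝ) ^ m * x) = s x := fun m x => by
    change ∑' n : ℤ, φ ((2 : ℝ) ^ n * ((2 : ℝ) ^ m * x)) ^ 2 = ∑' n : ℤ, φ ((2 : ℝ) ^ n * x) ^ 2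
    rw [← (Equiv.addRight m).tsum_eq (fun n : ℤ => φ ((2 : ℝ) ^ n * x) ^ 2)]
    simp only [Equiv.coe_addRight, zpow_add₀ (two_ne_zero (α := ℝ)), mul_assoc]
  refine ⟨fun x => φ x / √(s x), ?_, ?_, ?_⟩
  · rw [contDiff_iff_contDiffAt]
    intro x
    rcases eq_or_ne x 0 with rfl | hx
    · have he : (fun x => φ x / √(s x)) =ᶠ[nhds 0] fun _ => 0 := by
        have : ∀ᶠ x : ℝ in nhds 0, |x| < δ :=
          continuous_abs.continuousAt.eventually (gt_mem_nhds (by simpa using hδ))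
        filter_upwards [this] with x hx
        rw [hφ0 x fun h => (hU x h).not_gt hx, zero_div]
      exact contDiffAt_const.congr_of_eventuallyEq he
    · exact hφc.contDiffAt.div ((hsmooth x hx).sqrt (hspos x hx).ne')
        (Real.sqrt_pos.2 (hspos x hx)).ne'
  · intro x hx
    by_contra h
    exact hx (by simp only [hφ0 x h, zero_div])
  · intro x hx
    have h := (hsum x hx).hasSum.div_const (s x)
    rw [show ∑' n : ℤ, φ ((2 : ℝ) ^ n * x) ^ 2 = s x from rfl, div_self (hspos x hx).ne'] at h
    refine h.congr_fun fun n => ?_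
    rw [div_pow, hinv, Real.sq_sqrt (hspos x hx).le]

theorem mainTheorem9 (L : Set ℝ) (hL : IsParsevalFrameWaveletSet L) (N : ℤ)
    (hN : closure ((2 : ℝ) ^ N • L) ⊆ Set.Ioo (-(1 / 2) : ℝ) (1 / 2)) (ε : ℝ) (hε : 0 < ε) :
    ∃ ψ : 𝓢(ℝ, ℂ),
      ContDiff ℝ ∞ (𝓕 (ψ : ℝ → ℂ)) ∧ HasCompactSupport (𝓕 (ψ : ℝ → ℂ)) ∧
      IsParsevalFrameWavelet (ψ.toLp 2 volume) ∧
      ∀ S : Set ℝ, IsSupportOf (𝓕 (ψ : ℝ → ℂ)) S →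
        volume (S \ ((2 : ℝ) ^ N • L)) < ENNReal.ofReal ε := by
  have hK : MeasurableSet ((2 : ℝ) ^ N • L) := hL.1.const_smul₀ _
  have hcov : ∀ᵐ x : ℝ, ∃ n : ℤ, (2 : ℝ) ^ n * x ∈ (2 : ℝ) ^ N • L := by
    filter_upwards [exists_zpow_mul_mem_of_isParsevalFrameWaveletSet hL] with x hx
    obtain ⟨n, hn⟩ := hx
    refine ⟨N + n, ?_⟩
    rw [zpow_add₀ two_ne_zero, mul_assoc]
    exact Set.smul_mem_smul_set hn
  obtain ⟨U, hUo, hUsub, ⟨δ, hδ, hUδ⟩, hUcov, hUε⟩ :=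
    exists_isOpen_dyadic_cover hK (subset_closure.trans hN) hcov hε
  obtain ⟨g, hgc, hgU, hgsum⟩ := exists_contDiff_dyadic_partition hUo hUsub hδ hUδ hUcov
  have hg0 : ∀ x ∉ U, g x = 0 := fun x hx => Function.notMem_support.1 fun h => hx (hgU h)
  have hGc : ContDiff ℝ ∞ fun x => (g x : ℂ) := Complex.ofRealCLM.contDiff.comp hgc
  have hGs : HasCompactSupport fun x => (g x : ℂ) :=
    HasCompactSupport.intro (isCompact_Icc (a := (-(1 / 2) : ℝ)) (b := 1 / 2)) fun x hx => by
      rw [hg0 x fun h => hx (Set.Ioo_subset_Icc_self (hUsub h)), Complex.ofReal_zero]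
  let G : 𝓢(ℝ, ℂ) := hGs.toSchwartzMap hGc
  have hF : 𝓕 ((𝓕⁻ G : 𝓢(ℝ, ℂ)) : ℝ → ℂ) = fun x => (g x : ℂ) := by
    rw [← SchwartzMap.fourier_coe, FourierTransform.fourier_fourierInv_eq]
    rfl
  refine ⟨𝓕⁻ G, hF ▸ hGc, hF ▸ hGs, ?_, fun S hS => ?_⟩
  · refine isParsevalFrameWavelet_of_calderon hGc.continuous.measurable ?_ ?_ ?_
    · rw [SchwartzMap.toLp_fourier_eq, FourierTransform.fourier_fourierInv_eq]
      exact G.coeFn_toLp 2 volume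
    · intro x hx
      rw [hg0 x fun h => hx (hUsub h), Complex.ofReal_zero]
    · have h0 : ∀ᵐ x : ℝ, x ≠ 0 := Measure.ae_ne volume 0
      filter_upwards [h0] with x hx
      simpa only [Complex.norm_real, Real.norm_eq_abs, sq_abs] using hgsum x hx
  · rw [hF] at hS
    refine (measure_mono_ae ?_).trans_lt hUε
    filter_upwards [hS.2.2] with x hx hxS
    refine ⟨?_, hxS.2⟩
    by_contra h
    exact hx hxS.1 (by rw [hg0 x h, Complex.ofReal_zero])
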